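/- Let $n\ge 0$ be an integer. For $M\in\mathbb{F}_2^{n\times n}$, a (standard) matrix-vector query to $M$ is the unitary $U(M)\colon|x,y\rangle\mapsto|x,y+Mx\rangle$ and a phase query to $M$ is the unitary $\tilde U(M)\colon|x,y\rangle\mapsto(-1)^{y^{\top}Mx}|x,y\rangle$, where $x,y\in\mathbb{F}_2^n$. A $t$-query quantum algorithm starts in a fixed unit vector of (query register) $\otimes$ (finite-dimensional workspace), applies the query unitary $t$ times to the query register, interleaved with arbitrary fixed unitaries on the whole space, measures in the computational basis, and outputs a value in $\mathbb{F}_2$ that is a fixed function of the measurement outcome. It succeeds on $M$ if it outputs $\operatorname{tr} M$. (i) If $t<n/2$, then every $t$-query quantum algorithm, whether its queries are standard queries or phase queries to $M$, outputs $\operatorname{tr}M$ with probability at most $1/2$ when $M$ is uniformly random in $\mathbb{F}_2^{n\times n}$; in particular, for some $M$ its success probability is at most $1/2$. (ii) There is a quantum algorithm that makes $\lceil n/2\rceil$ standard matrix-vector queries and outputs $\operatorname{tr}M$ with probability $1$ for every $M\in\mathbb{F}_2^{n\times n}$. Moreover, there is a quantum algorithm that makes $\lceil n/2\rceil$ phase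 queries in parallel (it prepares a fixed state of $\lceil n/2\rceil$ query registers and a finite-dimensional workspace, applies $\tilde U(M)^{\otimes\lceil n/2\rceil}$ once to the query registers, and performs a fixed unitary followed by a computational-basis measurement) and outputs $\operatorname{tr}M$ with probability $1$ for every $M\in\mathbb{F}_2^{n\times n}$. -/

import Mathlib

open scoped Matrix Kronecker

namespace MatVec

/-- Vectors in `𝔽₂ⁿ`. -/
abbrev Vec (n : ℕ) : Type := Fin n → ZMod 2

/-- Square matrices over `𝔽₂`, the hidden inputs. -/
abbrev Mat (n : ℕ) : Type := Matrix (Fin n) (Fin n) (ZMod 2)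

/-- Labels `(x, y)` of the computational basis states `|x, y⟩` on which one query acts. -/
abbrev QReg (n : ℕ) : Type := Vec n × Vec n

/-- The standard matrix-vector query `U(M) : |x, y⟩ ↦ |x, y + M x⟩`. Column `(x, y)` of the matrix
is the image of the basis state `|x, y⟩`. -/
noncomputable def mvQuery {n : ℕ} (M : Mat n) : Matrix (QReg n) (QReg n) ℂ :=
  Matrix.of fun a b => if a = (b.1, b.2 + M *ᵥ b.1) then 1 else 0

/-- The matrix-vector phase query `|x, y⟩ ↦ (-1)^(yᵀ M x) |x, y⟩`. -/
noncomputable def phaseQuery {n : ℕ} (M : Mat n) : Matrix (QReg n) (QReg n) ℂ :=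
  Matrix.diagonal fun b => (-1 : ℂ) ^ (b.2 ⬝ᵥ (M *ᵥ b.1)).val

/-- The `ℓ`-fold tensor power `O ⊗ ⋯ ⊗ O` of an operator: `ℓ` parallel applications. -/
noncomputable def tensorPower {ι : Type} (ℓ : ℕ) (O : Matrix ι ι ℂ) :
    Matrix (Fin ℓ → ι) (Fin ℓ → ι) ℂ :=
  Matrix.of fun a b => ∏ i, O (a i) (b i)

/-- An (adaptive) `t`-query quantum algorithm with output in `𝔽₂`. Its state space is
`ℂ^ι ⊗ ℂ^d`, where the oracle acts on `ℂ^ι` and `ℂ^d` is a workspace. It starts in a unit vector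
`init`, makes `t` queries, applies the unitary `step i` after the `i`-th of them, finally measures
in the computational basis and returns the value of `out` at the measurement outcome. Neither
`init`, nor `step`, nor `out` depends on the oracle. -/
structure QueryAlgorithm (ι : Type) [Fintype ι] [DecidableEq ι] (d t : ℕ) where
  init : ι × Fin d → ℂ
  init_unit : ∑ a, ‖init a‖ ^ 2 = 1
  step : Fin t → Matrix.unitaryGroup (ι × Fin d) ℂ
  out : ι × Fin d → ZMod 2

namespace QueryAlgorithm

variable {ι : Type} [Fintype ι] [DecidableEq ι] {d t : ℕ}

/-- The state before the measurement,
`step (t-1) (O ⊗ 1) ⋯ step 1 (O ⊗ 1) step 0 (O ⊗ 1) init`, when the oracle is `O`. -/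
noncomputable def finalState (A : QueryAlgorithm ι d t) (O : Matrix ι ι ℂ) : ι × Fin d → ℂ :=
  Fin.foldl t
    (fun ψ i => (A.step i : Matrix (ι × Fin d) (ι × Fin d) ℂ) *ᵥ
      ((O ⊗ₖ (1 : Matrix (Fin d) (Fin d) ℂ)) *ᵥ ψ))
    A.init

/-- The probability that the algorithm with oracle `O` outputs `v` (Born rule). -/
noncomputable def prob (A : QueryAlgorithm ι d t) (O : Matrix ι ι ℂ) (v : ZMod 2) : ℝ :=
  ∑ a, if A.out a = v then ‖A.finalState O a‖ ^ 2 else 0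

end QueryAlgorithm

/-- A quantum algorithm making `ℓ` queries in parallel: it prepares an oracle-independent state of
`ℓ` query registers and a workspace, applies `O ⊗ ⋯ ⊗ O` (with `ℓ` factors) once, and then an
oracle-independent measurement. -/
abbrev ParallelAlgorithm (ι : Type) [Fintype ι] [DecidableEq ι] (d ℓ : ℕ) : Type :=
  QueryAlgorithm (Fin ℓ → ι) d 1

/-- The probability that the parallel algorithm outputs `v` when each of its `ℓ` queries is to `O`. -/
noncomputable def ParallelAlgorithm.parallelProb {ι : Type} [Fintype ι] [DecidableEq ι] {d ℓ : ℕ}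
    (A : ParallelAlgorithm ι d ℓ) (O : Matrix ι ι ℂ) (v : ZMod 2) : ℝ :=
  QueryAlgorithm.prob A (tensorPower ℓ O) v

/-- The probability that `A`, given the oracle `O M` of a uniformly random `M ∈ 𝔽₂^{n × n}`,
outputs the trace of `M`. -/
noncomputable def averageSuccess {n d t : ℕ} (A : QueryAlgorithm (QReg n) d t)
    (O : Mat n → Matrix (QReg n) (QReg n) ℂ) : ℝ :=
  (∑ M : Mat n, A.prob (O M) M.trace) / Fintype.card (Mat n)

end MatVec

/-! ### Signs, the Hadamard transform and unitarity of the queries -/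

namespace MatVec

/-! Lower bound: this is the polynomial method with rank in the role of degree. Entries of a phase
query are zero or characters `M ↦ (-1)^tr(BM)` with `B` of rank at most 1, and a standard query is a
phase query conjugated by a fixed transform (`mvQuery_eq`). Multiplying characters adds the matrices
`B`, so after `t` queries amplitudes are combinations of characters of rank at most `t`
(`finalState_mem_lowRankSpan`), and outcome probabilities of rank at most `2t`. The sign of the
trace is the character of the identity, of rank `n`; for `2t < n` it is orthogonal to all of these
(`sum_sign_trace_mul_eq_zero`), and the average success is exactly 1/2.

Algorithms: a phase query at `|eⱼ, eⱼ⟩` yields `(-1)^(M j j)`. Two branches in superposition each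
collect half of the diagonal, so their relative phase is `(-1)^(tr M)`, which a Hadamard gate reads
exactly (`exists_prob_eq_one`). -/

/-- The nontrivial character `v ↦ (-1)^v` of `𝔽₂`. -/
noncomputable def sign : AddChar (ZMod 2) ℂ where
  toFun v := (-1) ^ v.val
  map_zero_eq_one' := by simp
  map_add_eq_mul' a b := by
    rw [← pow_add, neg_one_pow_eq_pow_mod_two, neg_one_pow_eq_pow_mod_two (n := a.val + b.val),
      ZMod.val_add, Nat.mod_mod]

lemma sign_apply (v : ZMod 2) : sign v = (-1) ^ v.val := rfl

@[simp] lemma sign_one : sign 1 = -1 := by simp [sign_apply, ZMod.val_one]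

lemma sign_mul_self (v : ZMod 2) : sign v * sign v = 1 := by
  rw [← AddChar.map_add_eq_mul, CharTwo.add_self_eq_zero, AddChar.map_zero_eq_one]

lemma star_sign (v : ZMod 2) : star (sign v) = sign v := by
  simp [sign_apply]

lemma eq_zero_or_one (v : ZMod 2) : v = 0 ∨ v = 1 := by
  revert v
  decide

/-- Orthogonality: a nonzero additive functional to `𝔽₂` is balanced. -/
lemma sum_sign_eq_zero {G : Type*} [AddCommGroup G] [Fintype G] (φ : G →+ ZMod 2) {g : G}
    (hg : φ g ≠ 0) : ∑ x, sign (φ x) = 0 := by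
  have h1 : φ g = 1 := (eq_zero_or_one _).resolve_left hg
  have h : ∑ x, sign (φ x) = ∑ x, sign (φ (x + g)) :=
    (Equiv.sum_comp (Equiv.addRight g) fun x => sign (φ x)).symm
  simp only [map_add, AddChar.map_add_eq_mul, h1, sign_one, mul_neg, mul_one,
    Finset.sum_neg_distrib] at h
  exact CharZero.eq_neg_self_iff.mp h

lemma sum_sign_dotProduct {n : ℕ} (u : Vec n) :
    ∑ z : Vec n, sign (z ⬝ᵥ u) = if u = 0 then 2 ^ n else 0 := by
  split_ifs with h
  · subst h
    simp [AddChar.map_zero_eq_one, ZMod.card]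
  · obtain ⟨i, hi⟩ := Function.ne_iff.mp h
    refine sum_sign_eq_zero
      (AddMonoidHom.mk' (fun z : Vec n => z ⬝ᵥ u) fun a b => add_dotProduct a b u)
      (g := Pi.single i 1) ?_
    simpa using hi

/-- The Hadamard transform on the second half of the query register. -/
noncomputable def fourier (n : ℕ) : Matrix (QReg n) (QReg n) ℂ :=
  Matrix.of fun a b => if a.1 = b.1 then ((Real.sqrt 2 : ℂ) ^ n)⁻¹ * sign (a.2 ⬝ᵥ b.2) else 0

lemma phaseQuery_eq {n : ℕ} (M : Mat n) :
    phaseQuery M = Matrix.diagonal fun b => sign (b.2 ⬝ᵥ (M *ᵥ b.1)) := rfl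

lemma sqrt_two_pow_mul_self (n : ℕ) : (Real.sqrt 2 : ℂ) ^ n * (Real.sqrt 2 : ℂ) ^ n = 2 ^ n := by
  rw [← mul_pow, ← Complex.ofReal_mul, Real.mul_self_sqrt zero_le_two, Complex.ofReal_ofNat]

/-- A standard query is a phase query in the Fourier basis of the second register. -/
lemma mvQuery_eq {n : ℕ} (M : Mat n) :
    mvQuery M = fourier n * phaseQuery M * fourier n := by
  ext ⟨x, y⟩ ⟨x', y'⟩
  rw [phaseQuery_eq, Matrix.mul_apply, Fintype.sum_prod_type]
  simp only [Matrix.mul_diagonal, fourier, Matrix.of_apply, mvQuery, ite_mul, mul_ite, zero_mul,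
    mul_zero]
  rw [Finset.sum_eq_single x' (by
    intro b _ hb
    simp [hb]) (by simp)]
  by_cases hx : x = x'
  · subst hx
    have key : ∀ z : Vec n, ((Real.sqrt 2 : ℂ) ^ n)⁻¹ * sign (y ⬝ᵥ z) * sign (z ⬝ᵥ (M *ᵥ x)) *
        (((Real.sqrt 2 : ℂ) ^ n)⁻¹ * sign (z ⬝ᵥ y')) =
        (2 ^ n)⁻¹ * sign (z ⬝ᵥ (y + (y' + M *ᵥ x))) := by
      intro z
      rw [dotProduct_add, dotProduct_add, AddChar.map_add_eq_mul, AddChar.map_add_eq_mul,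
        ← sqrt_two_pow_mul_self, mul_inv, dotProduct_comm y z]
      ring
    simp only [if_true, key, ← Finset.mul_sum, sum_sign_dotProduct, Prod.mk.injEq, true_and]
    have : y + (y' + M *ᵥ x) = 0 ↔ y = y' + M *ᵥ x := by
      rw [← sub_eq_zero (b := y' + M *ᵥ x)]
      have : y - (y' + M *ᵥ x) = y + (y' + M *ᵥ x) := by
        ext i
        exact CharTwo.sub_eq_add (R := ZMod 2) _ _
      rw [this]
    simp only [this]
    split_ifs <;> simp
  · simp [hx]

lemma mvQuery_zero (n : ℕ) : mvQuery (0 : Mat n) = 1 := by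
  ext a b
  simp [mvQuery, Matrix.one_apply]

lemma phaseQuery_zero (n : ℕ) : phaseQuery (0 : Mat n) = 1 := by
  simp [phaseQuery_eq, AddChar.map_zero_eq_one]

/-- This is `mvQuery_eq` at `M = 0`, where both queries are the identity. -/
lemma fourier_mul_self (n : ℕ) : fourier n * fourier n = 1 := by
  simpa [mvQuery_zero, phaseQuery_zero] using (mvQuery_eq (0 : Mat n)).symm

lemma star_fourier (n : ℕ) : star (fourier n) = fourier n := by
  ext a b
  rw [Matrix.star_apply]
  simp only [fourier, Matrix.of_apply, eq_comm (a := b.1), dotProduct_comm b.2]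
  split_ifs
  · rw [star_mul', star_sign, star_inv₀, star_pow, Complex.star_def, Complex.conj_ofReal]
  · simp

lemma fourier_mem_unitaryGroup (n : ℕ) : fourier n ∈ Matrix.unitaryGroup (QReg n) ℂ := by
  rw [Matrix.mem_unitaryGroup_iff, star_fourier, fourier_mul_self]

lemma phaseQuery_mem_unitaryGroup {n : ℕ} (M : Mat n) :
    phaseQuery M ∈ Matrix.unitaryGroup (QReg n) ℂ := by
  rw [Matrix.mem_unitaryGroup_iff, phaseQuery_eq, Matrix.star_eq_conjTranspose,
    Matrix.diagonal_conjTranspose, Matrix.diagonal_mul_diagonal]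
  simp [star_sign, sign_mul_self, Pi.star_apply]

lemma mvQuery_mem_unitaryGroup {n : ℕ} (M : Mat n) :
    mvQuery M ∈ Matrix.unitaryGroup (QReg n) ℂ := by
  rw [mvQuery_eq]
  exact mul_mem (mul_mem (fourier_mem_unitaryGroup n) (phaseQuery_mem_unitaryGroup M))
    (fourier_mem_unitaryGroup n)

/-- Unitary matrices preserve the squared norm. -/
lemma sum_norm_sq_mulVec {κ : Type*} [Fintype κ] [DecidableEq κ] {U : Matrix κ κ ℂ}
    (hU : U ∈ Matrix.unitaryGroup κ ℂ) (ψ : κ → ℂ) :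
    ∑ a, ‖(U *ᵥ ψ) a‖ ^ 2 = ∑ a, ‖ψ a‖ ^ 2 := by
  have key : ∀ φ : κ → ℂ, ((∑ a, ‖φ a‖ ^ 2 : ℝ) : ℂ) = star φ ⬝ᵥ φ := by
    intro φ
    simp [dotProduct, Complex.conj_mul']
  apply Complex.ofReal_injective
  rw [key, key, Matrix.star_mulVec, Matrix.dotProduct_mulVec, Matrix.vecMul_vecMul,
    ← Matrix.star_eq_conjTranspose, Matrix.mem_unitaryGroup_iff'.mp hU, Matrix.vecMul_one]

lemma kronecker_one_mem_unitaryGroup {ι κ : Type*} [Fintype ι] [DecidableEq ι] [Fintype κ]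
    [DecidableEq κ] {O : Matrix ι ι ℂ} (hO : O ∈ Matrix.unitaryGroup ι ℂ) :
    O ⊗ₖ (1 : Matrix κ κ ℂ) ∈ Matrix.unitaryGroup (ι × κ) ℂ :=
  Matrix.kronecker_mem_unitary hO (one_mem _)

namespace QueryAlgorithm

variable {ι : Type} [Fintype ι] [DecidableEq ι] {d t : ℕ}

lemma sum_norm_sq_finalState (A : QueryAlgorithm ι d t) {O : Matrix ι ι ℂ}
    (hO : O ∈ Matrix.unitaryGroup ι ℂ) : ∑ a, ‖A.finalState O a‖ ^ 2 = 1 := by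
  rw [← A.init_unit, finalState]
  generalize A.init = ψ
  generalize A.step = S
  clear A
  induction t generalizing ψ with
  | zero => simp
  | succ t ih =>
    rw [Fin.foldl_succ, ih, sum_norm_sq_mulVec (S _).2,
      sum_norm_sq_mulVec (kronecker_one_mem_unitaryGroup hO)]

end QueryAlgorithm
end MatVec
-- Lower bound: characters of low rank
namespace MatVec

/-- The span of the characters of `𝔽₂^{n × n}` given by matrices of rank at most `k`. -/
noncomputable def lowRankSpan (n k : ℕ) : Submodule ℂ (Mat n → ℂ) :=
  Submodule.span ℂ {f | ∃ B : Mat n, B.rank ≤ k ∧ f = fun M => sign (B * M).trace}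

lemma character_mem_lowRankSpan {n k : ℕ} {B : Mat n} (hB : B.rank ≤ k) :
    (fun M : Mat n => sign (B * M).trace) ∈ lowRankSpan n k :=
  Submodule.subset_span ⟨B, hB, rfl⟩

lemma rank_add_le {m n R : Type*} [Fintype n] [Finite m] [Field R] (A B : Matrix m n R) :
    (A + B).rank ≤ A.rank + B.rank := by
  rw [Matrix.rank, Matrix.rank, Matrix.rank, Matrix.mulVecLin_add]
  exact (Submodule.finrank_mono (LinearMap.range_add_le _ _)).trans
    (Submodule.finrank_add_le_finrank_add_finrank _ _)

/-- The characters of `B` and `C` multiply to that of `B + C`, and rank is subadditive. -/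
lemma mul_mem_lowRankSpan {n j k : ℕ} {f g : Mat n → ℂ} (hf : f ∈ lowRankSpan n j)
    (hg : g ∈ lowRankSpan n k) : f * g ∈ lowRankSpan n (j + k) := by
  have h := Submodule.mul_mem_mul hf hg
  rw [lowRankSpan, lowRankSpan, Submodule.span_mul_span] at h
  refine Submodule.span_le.mpr ?_ h
  rintro _ ⟨_, ⟨B, hB, rfl⟩, _, ⟨C, hC, rfl⟩, rfl⟩
  have : ((fun M : Mat n => sign (B * M).trace) * fun M => sign (C * M).trace) =
      fun M => sign ((B + C) * M).trace := by
    ext M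
    rw [Pi.mul_apply, add_mul, Matrix.trace_add, AddChar.map_add_eq_mul]
  simp only [this]
  exact character_mem_lowRankSpan ((rank_add_le B C).trans (add_le_add hB hC))

lemma star_mem_lowRankSpan {n k : ℕ} {f : Mat n → ℂ} (hf : f ∈ lowRankSpan n k) :
    star f ∈ lowRankSpan n k := by
  induction hf using Submodule.span_induction with
  | mem f hf =>
    obtain ⟨B, hB, rfl⟩ := hf
    convert character_mem_lowRankSpan hB using 1
    ext M
    simp [star_sign]
  | zero => simp
  | add f g _ _ hf hg => simpa using add_mem hf hg
  | smul c f _ hf =>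
    rw [star_smul]
    exact Submodule.smul_mem _ _ hf

/-- Characters of rank less than `n` are orthogonal to the sign of the trace. -/
lemma sum_sign_trace_mul_eq_zero {n k : ℕ} (hk : k < n) {f : Mat n → ℂ}
    (hf : f ∈ lowRankSpan n k) : ∑ M, sign M.trace * f M = 0 := by
  induction hf using Submodule.span_induction with
  | mem f hf =>
    obtain ⟨B, hB, rfl⟩ := hf
    have hne : 1 + B ≠ 0 := by
      intro h
      have h1 : B = 1 := by
        ext i j
        have hij := congrFun (congrFun h i) j
        rw [Matrix.add_apply, Matrix.zero_apply, ← CharTwo.sub_eq_add, sub_eq_zero] at hij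
        exact hij.symm
      rw [h1, Matrix.rank_one, Fintype.card_fin] at hB
      omega
    obtain ⟨i, j, hij⟩ : ∃ i j, (1 + B) i j ≠ 0 := by
      by_contra! h
      exact hne (Matrix.ext h)
    -- The functional is nonzero at the matrix unit `E_ji`, since `tr((1 + B) E_ji) = (1 + B) i j`.
    have h := sum_sign_eq_zero (AddMonoidHom.mk' (fun M : Mat n => ((1 + B) * M).trace)
      fun M N => by rw [mul_add, Matrix.trace_add]) (g := Matrix.single j i 1)
      (by simpa [Matrix.trace_mul_single] using hij)
    simpa [add_mul, AddChar.map_add_eq_mul] using h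
  | zero => simp
  | add f g _ _ hf hg => simp [mul_add, Finset.sum_add_distrib, hf, hg]
  | smul c f _ hf => simp [mul_left_comm _ c, ← Finset.mul_sum, hf]

/-- On the diagonal, `yᵀ M x = tr(x yᵀ M)`, and the outer product `x yᵀ` has rank at most 1. -/
lemma phaseQuery_mem_lowRankSpan {n : ℕ} (a b : QReg n) :
    (fun M => phaseQuery M a b) ∈ lowRankSpan n 1 := by
  by_cases hab : a = b
  · subst hab
    convert character_mem_lowRankSpan (Matrix.rank_vecMulVec_le a.1 a.2) using 2 with M
    rw [phaseQuery_eq, Matrix.diagonal_apply_eq, Matrix.vecMulVec_mul,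
      Matrix.trace_vecMulVec, Matrix.dotProduct_mulVec, dotProduct_comm]
  · simp only [phaseQuery_eq, Matrix.diagonal_apply_ne _ hab]
    exact zero_mem _

lemma mvQuery_mem_lowRankSpan {n : ℕ} (a b : QReg n) :
    (fun M => mvQuery M a b) ∈ lowRankSpan n 1 := by
  have : (fun M => mvQuery M a b) = ∑ c, ∑ e, (fourier n a e * fourier n c b) •
      fun M => phaseQuery M e c := by
    ext M
    simp only [mvQuery_eq, Matrix.mul_apply, Finset.sum_mul, Finset.sum_apply, Pi.smul_apply,
      smul_eq_mul]
    exact Finset.sum_congr rfl fun _ _ => Finset.sum_congr rfl fun _ _ => by ring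
  rw [this]
  exact sum_mem fun c _ => sum_mem fun e _ =>
    Submodule.smul_mem _ _ (phaseQuery_mem_lowRankSpan e c)

lemma mulVec_mem_lowRankSpan {n k j : ℕ} {κ : Type*} [Fintype κ] {O : Mat n → Matrix κ κ ℂ}
    {ψ : Mat n → κ → ℂ} (hO : ∀ a b, (fun M => O M a b) ∈ lowRankSpan n j)
    (hψ : ∀ a, (fun M => ψ M a) ∈ lowRankSpan n k) (a : κ) :
    (fun M => (O M *ᵥ ψ M) a) ∈ lowRankSpan n (j + k) := by
  have : (fun M => (O M *ᵥ ψ M) a) = ∑ b, (fun M => O M a b) * fun M => ψ M b := by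
    ext M
    simp [Matrix.mulVec, dotProduct]
  rw [this]
  exact sum_mem fun b _ => mul_mem_lowRankSpan (hO a b) (hψ b)

lemma const_mem_lowRankSpan {n : ℕ} (c : ℂ) (k : ℕ) :
    (fun _ : Mat n => c) ∈ lowRankSpan n k := by
  have h := Submodule.smul_mem _ c
    (character_mem_lowRankSpan (n := n) (k := k) (B := 0) (by simp))
  convert h using 1
  ext M
  simp [AddChar.map_zero_eq_one]

namespace QueryAlgorithm

/-- After `t` queries, the amplitudes only involve characters of rank at most `t`. -/
lemma finalState_mem_lowRankSpan {n : ℕ} {ι : Type} [Fintype ι] [DecidableEq ι] {d t : ℕ}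
    (A : QueryAlgorithm ι d t) {O : Mat n → Matrix ι ι ℂ}
    (hO : ∀ a b, (fun M => O M a b) ∈ lowRankSpan n 1) (a : ι × Fin d) :
    (fun M => A.finalState (O M) a) ∈ lowRankSpan n t := by
  simp only [finalState]
  generalize A.init = ψ
  generalize A.step = S
  clear A
  induction t generalizing a with
  | zero => simpa using const_mem_lowRankSpan (ψ a) 0
  | succ t ih =>
    simp only [Fin.foldl_succ_last]
    have hO' : ∀ a b, (fun M => (O M ⊗ₖ (1 : Matrix (Fin d) (Fin d) ℂ)) a b) ∈
        lowRankSpan n 1 := by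
      intro a b
      convert Submodule.smul_mem _ ((1 : Matrix (Fin d) (Fin d) ℂ) a.2 b.2) (hO a.1 b.1) using 1
      ext M
      simp [Matrix.kroneckerMap_apply, mul_comm]
    have h := mulVec_mem_lowRankSpan (j := 0)
      (fun a b => const_mem_lowRankSpan ((S (Fin.last t) : Matrix (ι × Fin d) (ι × Fin d) ℂ) a b) 0)
      (mulVec_mem_lowRankSpan hO' fun b => ih b fun i => S i.castSucc) a
    rwa [zero_add, add_comm 1 t] at h

lemma averageSuccess_eq_half {n d t : ℕ} (A : QueryAlgorithm (QReg n) d t)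
    {O : Mat n → Matrix (QReg n) (QReg n) ℂ} (hU : ∀ M, O M ∈ Matrix.unitaryGroup (QReg n) ℂ)
    (hO : ∀ a b, (fun M => O M a b) ∈ lowRankSpan n 1) (ht : 2 * t < n) :
    averageSuccess A O = 1 / 2 := by
  -- On `𝔽₂`, `sign u * sign v` is 1 if `u = v` and -1 otherwise. The bias thus becomes a
  -- correlation of `sign (tr M)` with squared amplitudes.
  have hprob : ∀ M, ((2 * A.prob (O M) M.trace - 1 : ℝ) : ℂ) = ∑ a, sign (A.out a) *
      (sign M.trace * (A.finalState (O M) a * star (A.finalState (O M) a))) := by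
    intro M
    have h : 2 * A.prob (O M) M.trace - 1 = ∑ a, ((if A.out a = M.trace then 2 else 0) - 1) *
        ‖A.finalState (O M) a‖ ^ 2 := by
      simp only [sub_mul, Finset.sum_sub_distrib, one_mul, A.sum_norm_sq_finalState (hU M), prob,
        Finset.mul_sum, ite_mul, mul_ite, zero_mul, mul_zero]
    rw [h, Complex.ofReal_sum]
    refine Finset.sum_congr rfl fun a _ => ?_
    rw [Complex.star_def, Complex.mul_conj', ← mul_assoc, Complex.ofReal_mul, Complex.ofReal_pow]
    congr 1
    rcases eq_zero_or_one (A.out a) with h1 | h1 <;> rcases eq_zero_or_one M.trace with h2 | h2 <;>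
      rw [h1, h2] <;> simp [AddChar.map_zero_eq_one] <;> norm_num
  have hsum : ∑ M : Mat n, (2 * A.prob (O M) M.trace - 1) = 0 := by
    apply Complex.ofReal_injective
    rw [Complex.ofReal_sum, Finset.sum_congr rfl fun M _ => hprob M, Finset.sum_comm]
    simp only [← Finset.mul_sum, Complex.ofReal_zero]
    refine Finset.sum_eq_zero fun a _ => ?_
    have hmem := mul_mem_lowRankSpan (A.finalState_mem_lowRankSpan hO a)
      (star_mem_lowRankSpan (A.finalState_mem_lowRankSpan hO a))
    have h0 := sum_sign_trace_mul_eq_zero (by omega) hmem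
    exact mul_eq_zero_of_right _ h0
  have hcard : (Fintype.card (Mat n) : ℝ) ≠ 0 := Nat.cast_ne_zero.mpr Fintype.card_ne_zero
  rw [averageSuccess, div_eq_div_iff hcard two_ne_zero]
  simp only [Finset.sum_sub_distrib, ← Finset.mul_sum, Finset.sum_const, Finset.card_univ,
    nsmul_eq_mul, mul_one] at hsum
  linarith

end QueryAlgorithm

lemma exists_prob_le_of_averageSuccess_le {n d t : ℕ} {A : QueryAlgorithm (QReg n) d t}
    {O : Mat n → Matrix (QReg n) (QReg n) ℂ} {c : ℝ} (h : averageSuccess A O ≤ c) :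
    ∃ M : Mat n, A.prob (O M) M.trace ≤ c := by
  have hcard : (0 : ℝ) < Fintype.card (Mat n) := Nat.cast_pos.mpr Fintype.card_pos
  rw [averageSuccess, div_le_iff₀ hcard] at h
  obtain ⟨M, -, hM⟩ := Finset.exists_le_of_sum_le (s := Finset.univ)
    (f := fun M : Mat n => A.prob (O M) M.trace) (g := fun _ => c) Finset.univ_nonempty
    (by simpa [mul_comm] using h)
  exact ⟨M, hM⟩

end MatVec
-- Exact algorithms: two interfering paths
namespace MatVec

namespace QueryAlgorithm

variable {ι : Type} [Fintype ι] [DecidableEq ι] {d t : ℕ}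

/-- A fixed unitary can be applied before the final measurement. -/
lemma exists_finalState_eq_mulVec (A : QueryAlgorithm ι d t)
    {V : Matrix (ι × Fin d) (ι × Fin d) ℂ} (hV : V ∈ Matrix.unitaryGroup (ι × Fin d) ℂ)
    (out : ι × Fin d → ZMod 2) :
    ∃ A' : QueryAlgorithm ι d t, A'.out = out ∧
      ∀ O, A'.finalState O = V *ᵥ A.finalState O := by
  cases t with
  | zero =>
    -- Without queries there is no last step to absorb `V`, so it goes into the initial state.
    exact ⟨⟨V *ᵥ A.init, by rw [sum_norm_sq_mulVec hV, A.init_unit], A.step, out⟩, rfl,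
      fun O => by simp [finalState]⟩
  | succ t =>
    refine ⟨⟨A.init, A.init_unit, Fin.snoc (α := fun _ => Matrix.unitaryGroup (ι × Fin d) ℂ)
      (fun i => A.step i.castSucc) (⟨V, hV⟩ * A.step (Fin.last t)), out⟩, rfl, fun O => ?_⟩
    simp [finalState, Fin.foldl_succ_last, Matrix.mulVec_mulVec, mul_assoc]

/-- Conjugating the oracle by a fixed unitary does not change what algorithms can do. -/
lemma exists_prob_conj (A : QueryAlgorithm ι d t) {V : Matrix ι ι ℂ}
    (hV : V ∈ Matrix.unitaryGroup ι ℂ) :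
    ∃ A' : QueryAlgorithm ι d t, ∀ O v, A'.prob (V * O * star V) v = A.prob O v := by
  set W : Matrix (ι × Fin d) (ι × Fin d) ℂ := V ⊗ₖ (1 : Matrix (Fin d) (Fin d) ℂ) with hW
  have hWu : W ∈ Matrix.unitaryGroup (ι × Fin d) ℂ := kronecker_one_mem_unitaryGroup hV
  have hsW : star W * W = 1 := Matrix.mem_unitaryGroup_iff'.mp hWu
  -- `B` runs `A` in the basis rotated by `W`; applying `star W` before the measurement undoes the
  -- rotation.
  let B : QueryAlgorithm ι d t := ⟨W *ᵥ A.init, by rw [sum_norm_sq_mulVec hWu, A.init_unit],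
    fun i => ⟨W, hWu⟩ * A.step i * star ⟨W, hWu⟩, A.out⟩
  have hO : ∀ O : Matrix ι ι ℂ, (V * O * star V) ⊗ₖ (1 : Matrix (Fin d) (Fin d) ℂ) =
      W * (O ⊗ₖ (1 : Matrix (Fin d) (Fin d) ℂ)) * star W := by
    intro O
    rw [hW, Matrix.star_eq_conjTranspose, Matrix.star_eq_conjTranspose,
      Matrix.conjTranspose_kronecker, Matrix.conjTranspose_one, ← Matrix.mul_kronecker_mul,
      ← Matrix.mul_kronecker_mul, one_mul, one_mul]
  have hB : ∀ O, B.finalState (V * O * star V) = W *ᵥ A.finalState O := by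
    intro O
    simp only [finalState, B, hO]
    generalize A.init = ψ
    generalize A.step = S
    clear B A
    induction t generalizing ψ with
    | zero => simp
    | succ t ih =>
      rw [Fin.foldl_succ, Fin.foldl_succ, ← ih]
      congr 1
      simp only [Submonoid.coe_mul, Matrix.mulVec_mulVec, Unitary.coe_star]
      congr 1
      simp only [mul_assoc, hsW, mul_one]
      simp only [← mul_assoc _ W, hsW, one_mul]
  obtain ⟨C, hout, hC⟩ := B.exists_finalState_eq_mulVec (Unitary.star_mem hWu) A.out
  refine ⟨C, fun O v => ?_⟩
  simp only [prob, hC, hB, hout, Matrix.mulVec_mulVec, hsW, Matrix.one_mulVec]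

/-- With a diagonal oracle, each workspace state `w` can trace its own path `pos · w` through the
query register, collecting the phases met on the way. -/
lemma exists_walk [AddCommGroup ι] (t : ℕ) (pos : ℕ → Fin d → ι) (amp : Fin d → ℂ)
    (hamp : ∑ w, ‖amp w‖ ^ 2 = 1) :
    ∃ A : QueryAlgorithm ι d t, ∀ f : ι → ℂ, A.finalState (Matrix.diagonal f) =
      fun p => if p.1 = pos t p.2 then amp p.2 * ∏ i ∈ Finset.range t, f (pos i p.2) else 0 := by
  -- The permutation matrix of `σ` sends `ψ` to `ψ ∘ σ`, so `σ` is the inverse of the intended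
  -- displacement.
  let σ (i : ℕ) : Equiv.Perm (ι × Fin d) :=
    { toFun := fun p => (p.1 - (pos (i + 1) p.2 - pos i p.2), p.2)
      invFun := fun p => (p.1 + (pos (i + 1) p.2 - pos i p.2), p.2)
      left_inv := fun p => by simp
      right_inv := fun p => by simp }
  have hσ : ∀ i, (σ i).permMatrix ℂ ∈ Matrix.unitaryGroup (ι × Fin d) ℂ := by
    intro i
    rw [Matrix.mem_unitaryGroup_iff, Matrix.star_eq_conjTranspose, Matrix.conjTranspose_permMatrix,
      ← Matrix.permMatrix_mul]
    simp
  refine ⟨⟨fun p => if p.1 = pos 0 p.2 then amp p.2 else 0, ?_, fun i => ⟨_, hσ i⟩, 0⟩,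
    fun f => ?_⟩
  · rw [Fintype.sum_prod_type_right, ← hamp]
    refine Finset.sum_congr rfl fun w _ => ?_
    rw [Finset.sum_eq_single (pos 0 w) (by intro b _ hb; simp [hb]) (by simp)]
    simp
  · simp only [finalState]
    induction t with
    | zero => simp
    | succ t ih =>
      rw [Fin.foldl_succ_last]
      simp only [Fin.val_castSucc, ih, Fin.val_last]
      rw [Matrix.permMatrix_mulVec]
      ext ⟨a, w⟩
      have hdiag : Matrix.diagonal f ⊗ₖ (1 : Matrix (Fin d) (Fin d) ℂ) =
          Matrix.diagonal fun p => f p.1 := by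
        rw [← Matrix.diagonal_one, Matrix.diagonal_kronecker_diagonal]
        simp
      have hiff : a - (pos (t + 1) w - pos t w) = pos t w ↔ a = pos (t + 1) w := by
        rw [sub_eq_iff_eq_add, add_sub_cancel]
      simp only [hdiag, Function.comp_apply, Matrix.mulVec_diagonal, σ, Equiv.coe_fn_mk, hiff]
      split_ifs with h
      · subst h
        rw [sub_sub_cancel, Finset.prod_range_succ]
        ring
      · simp

end QueryAlgorithm

/-- A unitary acting as the Hadamard gate on two basis states. -/
lemma exists_hadamard {κ : Type*} [Fintype κ] [DecidableEq κ] {p q : κ} (hpq : p ≠ q) :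
    ∃ V ∈ Matrix.unitaryGroup κ ℂ, ∀ α β : ℂ, V *ᵥ (Pi.single p α + Pi.single q β) =
      Pi.single p ((Real.sqrt 2 : ℂ)⁻¹ * (α + β)) + Pi.single q ((Real.sqrt 2 : ℂ)⁻¹ * (α - β)) := by
  set c : ℂ := (Real.sqrt 2 : ℂ)⁻¹ with hc
  have hcc : c * c = 1 / 2 := by
    rw [hc, ← mul_inv, ← Complex.ofReal_mul, Real.mul_self_sqrt zero_le_two]
    norm_num
  have hsc : star c = c := by
    rw [hc, star_inv₀, Complex.star_def, Complex.conj_ofReal]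
  -- The corrections `c - 1` and `-c - 1` turn the diagonal ones of the identity into `c` and `-c`.
  let V : Matrix κ κ ℂ := 1 + Matrix.single p p (c - 1) + Matrix.single p q c +
    Matrix.single q p c + Matrix.single q q (-c - 1)
  have hstar : star V = V := by
    simp only [V, star_add, star_one, Matrix.star_eq_conjTranspose, Matrix.conjTranspose_single,
      star_sub, star_neg, hsc]
    abel
  have hV : ∀ ψ i, (V *ᵥ ψ) i = if i = p then c * (ψ p + ψ q) else
      if i = q then c * (ψ p - ψ q) else ψ i := by
    intro ψ i
    simp only [V, Matrix.add_mulVec, Matrix.one_mulVec, Matrix.single_mulVec, Pi.add_apply,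
      Function.update_apply, Pi.zero_apply]
    by_cases hp : i = p
    · subst hp
      simp [hpq]
      ring
    · by_cases hq : i = q
      · subst hq
        simp [hp]
        ring
      · simp [hp, hq]
  have hVV : V * V = 1 := by
    refine Matrix.ext_of_mulVec_single fun j => ?_
    generalize (Pi.single j 1 : κ → ℂ) = ψ
    rw [← Matrix.mulVec_mulVec, Matrix.one_mulVec]
    ext i
    simp only [hV, if_true, if_neg hpq.symm]
    split_ifs with h1 h2
    · rw [h1]
      linear_combination 2 * ψ p * hcc
    · rw [h2]
      linear_combination 2 * ψ q * hcc
    · rfl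
  refine ⟨V, by rw [Matrix.mem_unitaryGroup_iff, hstar, hVV], fun α β => ?_⟩
  ext i
  rw [hV]
  by_cases hp : i = p
  · subst hp
    simp [hpq, hpq.symm]
  · by_cases hq : i = q
    · subst hq
      simp [hp, hpq]
    · simp [hp, hq]

/-- If the phases met on two paths through the query register multiply to `(-1)^v`, then letting
the paths interfere determines `v` with certainty. -/
lemma exists_prob_eq_one {α ι : Type} [Fintype ι] [DecidableEq ι] [AddCommGroup ι]
    (f : α → ι → ℂ) (v : α → ZMod 2) (t : ℕ) (pos : ℕ → Fin 2 → ι)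
    (hf : ∀ M a, f M a * f M a = 1)
    (h : ∀ M, (∏ i ∈ Finset.range t, f M (pos i 0)) * ∏ i ∈ Finset.range t, f M (pos i 1) =
      sign (v M)) :
    ∃ A : QueryAlgorithm ι 2 t, ∀ M, A.prob (Matrix.diagonal (f M)) (v M) = 1 := by
  set c : ℂ := (Real.sqrt 2 : ℂ)⁻¹ with hc
  have hcc : c * c = 1 / 2 := by
    rw [hc, ← mul_inv, ← Complex.ofReal_mul, Real.mul_self_sqrt zero_le_two]
    norm_num
  have hnc : ‖c‖ ^ 2 = 1 / 2 := by
    rw [← norm_pow, sq, hcc]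
    norm_num
  obtain ⟨A, hA⟩ := QueryAlgorithm.exists_walk t pos (fun _ => c) (by simp [hnc])
  -- The paths may end at the same query label; the workspace bit keeps them distinct.
  have hpq : (pos t 0, (0 : Fin 2)) ≠ (pos t 1, 1) := fun h => by simpa using congrArg Prod.snd h
  generalize hp : (pos t 0, (0 : Fin 2)) = p at hpq
  generalize hq : (pos t 1, (1 : Fin 2)) = q at hpq
  obtain ⟨V, hVu, hV⟩ := exists_hadamard hpq
  obtain ⟨B, hout, hB⟩ := A.exists_finalState_eq_mulVec hVu fun a => if a = q then 1 else 0
  refine ⟨B, fun M => ?_⟩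
  set P := ∏ i ∈ Finset.range t, f M (pos i 0) with hP
  have hPP : P * P = 1 := by
    rw [hP, ← Finset.prod_mul_distrib]
    exact Finset.prod_eq_one fun i _ => hf M _
  have hQ : ∏ i ∈ Finset.range t, f M (pos i 1) = P * sign (v M) := by
    rw [← h M, ← mul_assoc, ← hP, hPP, one_mul]
  have hnP : ‖P‖ ^ 2 = 1 := by
    rw [← norm_pow, sq, hPP, norm_one]
  have hfin : A.finalState (Matrix.diagonal (f M)) =
      Pi.single p (c * P) + Pi.single q (c * (P * sign (v M))) := by
    rw [hA, ← hp, ← hq]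
    ext ⟨a, w⟩
    fin_cases w <;> simp [Pi.single_apply, ← hP, hQ]
  rw [QueryAlgorithm.prob, hB, hfin, hV, hout, ← hc]
  have e0 : c * (c * P + c * P) = P := by linear_combination 2 * P * hcc
  rcases eq_zero_or_one (v M) with h0 | h1
  · rw [h0, AddChar.map_zero_eq_one, mul_one, e0, sub_self, mul_zero, Pi.single_zero, add_zero,
      Finset.sum_eq_single p (by intro b _ hb; simp [hb]) (by simp)]
    simp [hpq, hnP]
  · rw [h1, sign_one, mul_neg_one, mul_neg, ← sub_eq_add_neg, sub_self, mul_zero, Pi.single_zero,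
      zero_add, sub_neg_eq_add, e0, Finset.sum_eq_single q (by intro b _ hb; simp [hb]) (by simp)]
    simp [hnP]

/-- The basis state `|eⱼ, eⱼ⟩`, on which a phase query reads the diagonal entry `M j j`, or
`|0, 0⟩` when `j` is out of range. -/
def diagQuery (n j : ℕ) : QReg n :=
  if h : j < n then (Pi.single ⟨j, h⟩ 1, Pi.single ⟨j, h⟩ 1) else 0

/-- The two blocks of length `t` cover the diagonal; surplus indices query `|0, 0⟩` and contribute
the factor 1, which handles odd `n`. -/
lemma prod_diagQuery {n : ℕ} (M : Mat n) {t : ℕ} (ht : n ≤ t + t) :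
    (∏ i ∈ Finset.range t, sign ((diagQuery n i).2 ⬝ᵥ (M *ᵥ (diagQuery n i).1))) *
      ∏ i ∈ Finset.range t, sign ((diagQuery n (t + i)).2 ⬝ᵥ (M *ᵥ (diagQuery n (t + i)).1)) =
      sign M.trace := by
  rw [← Finset.prod_range_add fun i => sign ((diagQuery n i).2 ⬝ᵥ (M *ᵥ (diagQuery n i).1)),
    ← Finset.prod_subset (Finset.range_mono ht), ← Fin.prod_univ_eq_prod_range
      (fun i => sign ((diagQuery n i).2 ⬝ᵥ (M *ᵥ (diagQuery n i).1))), Matrix.trace,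
    show ∀ g : Fin n → ZMod 2, sign (∑ i, g i) = ∏ i, sign (g i) from
      fun g => map_prod sign.toMonoidHom (fun i => Multiplicative.ofAdd (g i)) Finset.univ]
  · exact Finset.prod_congr rfl fun i _ => by simp [diagQuery]
  · intro i _ hi
    rw [diagQuery, dif_neg (by simpa using hi)]
    simp [AddChar.map_zero_eq_one]

lemma exists_mvQuery_prob_eq_one {n t : ℕ} (ht : n ≤ t + t) :
    ∃ A : QueryAlgorithm (QReg n) 2 t, ∀ M : Mat n, A.prob (mvQuery M) M.trace = 1 := by
  obtain ⟨A, hA⟩ := exists_prob_eq_one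
    (fun (M : Mat n) (b : QReg n) => sign (b.2 ⬝ᵥ (M *ᵥ b.1))) Matrix.trace t
    (fun i w => diagQuery n (if w = 0 then i else t + i)) (fun _ _ => sign_mul_self _)
    (fun M => prod_diagQuery M ht)
  obtain ⟨B, hB⟩ := A.exists_prob_conj (fourier_mem_unitaryGroup n)
  refine ⟨B, fun M => ?_⟩
  rw [mvQuery_eq, phaseQuery_eq, ← hA M, ← hB, star_fourier]

lemma tensorPower_diagonal {ι : Type} [DecidableEq ι] (ℓ : ℕ) (f : ι → ℂ) :
    tensorPower ℓ (Matrix.diagonal f) = Matrix.diagonal fun a => ∏ i, f (a i) := by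
  ext a b
  rw [tensorPower, Matrix.of_apply]
  by_cases hab : a = b
  · subst hab
    simp
  · obtain ⟨i, hi⟩ := Function.ne_iff.mp hab
    rw [Matrix.diagonal_apply_ne _ hab]
    exact Finset.prod_eq_zero (Finset.mem_univ i) (Matrix.diagonal_apply_ne _ hi)

/-- A tensor power of a diagonal oracle is diagonal, so the interference argument applies to one
query whose label is the whole tuple of a branch. -/
lemma exists_phaseQuery_parallelProb_eq_one {n t : ℕ} (ht : n ≤ t + t) :
    ∃ A : ParallelAlgorithm (QReg n) 2 t,
      ∀ M : Mat n, A.parallelProb (phaseQuery M) M.trace = 1 := by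
  obtain ⟨A, hA⟩ := exists_prob_eq_one
    (fun (M : Mat n) (a : Fin t → QReg n) => ∏ i, sign ((a i).2 ⬝ᵥ (M *ᵥ (a i).1)))
    Matrix.trace 1 (fun _ w i => diagQuery n (if w = 0 then i else t + i))
    (fun _ _ => by
      rw [← Finset.prod_mul_distrib]
      exact Finset.prod_eq_one fun _ _ => sign_mul_self _)
    (fun M => by
      rw [← prod_diagQuery M ht, Finset.prod_range_one, Finset.prod_range_one,
        ← Fin.prod_univ_eq_prod_range, ← Fin.prod_univ_eq_prod_range
          (fun i => sign ((diagQuery n (t + i)).2 ⬝ᵥ (M *ᵥ (diagQuery n (t + i)).1)))]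
      rfl)
  refine ⟨A, fun M => ?_⟩
  rw [ParallelAlgorithm.parallelProb, phaseQuery_eq, tensorPower_diagonal]
  exact hA M

end MatVec

theorem mainTheorem4 (n : ℕ) :
    -- fewer than `n / 2` queries, standard or phase: no better than guessing
    (∀ O : MatVec.Mat n → Matrix (MatVec.QReg n) (MatVec.QReg n) ℂ,
      O = MatVec.mvQuery ∨ O = MatVec.phaseQuery →
      ∀ (t d : ℕ), (t : ℝ) < (n : ℝ) / 2 →
      ∀ A : MatVec.QueryAlgorithm (MatVec.QReg n) d t,
        MatVec.averageSuccess A O ≤ 1 / 2 ∧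
        ∃ M : MatVec.Mat n, A.prob (O M) M.trace ≤ 1 / 2) ∧
    -- an exact algorithm with `⌈n / 2⌉` standard queries
    (∃ (d : ℕ) (A : MatVec.QueryAlgorithm (MatVec.QReg n) d ⌈(n : ℝ) / 2⌉₊),
      ∀ M : MatVec.Mat n, A.prob (MatVec.mvQuery M) M.trace = 1) ∧
    -- an exact algorithm with `⌈n / 2⌉` phase queries, made in parallel
    (∃ (d : ℕ) (A : MatVec.ParallelAlgorithm (MatVec.QReg n) d ⌈(n : ℝ) / 2⌉₊),
      ∀ M : MatVec.Mat n,
        MatVec.ParallelAlgorithm.parallelProb A (MatVec.phaseQuery M) M.trace = 1) := by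
  have hceil : n ≤ ⌈(n : ℝ) / 2⌉₊ + ⌈(n : ℝ) / 2⌉₊ := by
    have h := Nat.le_ceil ((n : ℝ) / 2)
    rw [← Nat.cast_le (α := ℝ)]
    push_cast
    linarith
  refine ⟨fun O hO t d ht A => ?_, ⟨2, MatVec.exists_mvQuery_prob_eq_one hceil⟩,
    ⟨2, MatVec.exists_phaseQuery_parallelProb_eq_one hceil⟩⟩
  have ht' : 2 * t < n := by
    rw [← Nat.cast_lt (α := ℝ)]
    push_cast
    linarith
  have havg : MatVec.averageSuccess A O ≤ 1 / 2 := by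
    rcases hO with rfl | rfl
    · exact (A.averageSuccess_eq_half MatVec.mvQuery_mem_unitaryGroup
        MatVec.mvQuery_mem_lowRankSpan ht').le
    · exact (A.averageSuccess_eq_half MatVec.phaseQuery_mem_unitaryGroup
        MatVec.phaseQuery_mem_lowRankSpan ht').le
  exact ⟨havg, MatVec.exists_prob_le_of_averageSuccess_le havg⟩
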